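/- **Theorem 1.6.** All graphs are finite, undirected, without loops or multiple edges. For a graph $G$ with adjacency matrix $A(G)$ and diagonal degree matrix $D(G)$, let $q(G)$ denote the largest eigenvalue of the signless Laplacian matrix $Q(G)=D(G)+A(G)$. Write $K_m$ for the complete graph of order $m$, $\cup$ for disjoint union, and $G_1\vee G_2$ for the join, obtained from $G_1\cup G_2$ by adding all edges between a vertex of $G_1$ and a vertex of $G_2$. For positive integers $a\le b$, a graph $H$ contains a fractional $[a,b]$-factor if there is a function $h:E(H)\to[0,1]$ such that $a\le\sum_{e\ni v}h(e)\le b$ for every vertex $v$ of $H$, the sum being over the edges of $H$ incident with $v$. A graph $G$ is a fractional $[a,b]$-deleted graph if, for every edge $e\in E(G)$, the graph $G-e$ contains a fractional $[a,b]$-factor. Let $a$ and $b$ be positive integers with $b\ge\max\{a,3\}$, and let $G$ be a connected graph of order $n$ with $n\ge\max\{a+2,7\}$. If $$q(G)>2n-4+\frac{a+1}{n-1}\qquad\text{and}\qquad q(G)>q\bigl(K_a\vee(K_{n-a-1}\cup K_1)\bigr),$$ then $G$ is a fractional $[a,b]$-deleted graph. -/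

import Mathlib

namespace FracDeleted

/-- The signless Laplacian matrix `Q(G) = D(G) + A(G)`, over the reals. -/
noncomputable def signlessLaplacian {V : Type*} [Fintype V] (G : SimpleGraph V) :
    Matrix V V ℝ :=
  open Classical in G.degMatrix ℝ + G.adjMatrix ℝ

/-- The signless Laplacian spectral radius `q(G)`: the largest (real) eigenvalue of `Q(G)`.
The matrix is real symmetric, so for a nonempty vertex set the set of eigenvalues is finite and
nonempty and its supremum is a maximum. -/
noncomputable def signlessSpectralRadius {V : Type*} [Fintype V] (G : SimpleGraph V) : ℝ :=
  sSup {μ : ℝ | Module.End.HasEigenvalue (signlessLaplacian G).mulVecLin μ}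

/-- The join `G ∨ H`: the disjoint union together with all edges between the two parts. -/
def join {V W : Type*} (G : SimpleGraph V) (H : SimpleGraph W) : SimpleGraph (V ⊕ W) :=
  (G ⊕g H) ⊔ completeBipartiteGraph V W

/-- The graph `K_a ∨ (K_{n-a-1} ∪ K_1)` (of order `n` when `a + 1 ≤ n`). -/
def extremalGraph (n a : ℕ) : SimpleGraph (Fin a ⊕ (Fin (n - a - 1) ⊕ Fin 1)) :=
  join (⊤ : SimpleGraph (Fin a)) ((⊤ : SimpleGraph (Fin (n - a - 1))) ⊕g (⊤ : SimpleGraph (Fin 1)))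

/-- `h` is the indicator function of a fractional `[a,b]`-factor of `G`: it takes values in `[0,1]`
on the edges of `G`, and at every vertex its values on the incident edges sum to a number in
`[a,b]`. Values of `h` off the edge set of `G` are never used. -/
def IsFractionalFactorIndicator {V : Type*} [Fintype V] (G : SimpleGraph V) (a b : ℕ)
    (h : Sym2 V → ℝ) : Prop :=
  open Classical in
  (∀ e ∈ G.edgeSet, 0 ≤ h e ∧ h e ≤ 1) ∧
    ∀ v : V, (a : ℝ) ≤ ∑ e ∈ G.incidenceFinset v, h e ∧ ∑ e ∈ G.incidenceFinset v, h e ≤ (b : ℝ)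

/-- `G` contains a fractional `[a,b]`-factor. (The factor itself is the spanning subgraph whose
edges are those `e` with `h e > 0`; it is determined by its indicator function `h`.) -/
def HasFractionalFactor {V : Type*} [Fintype V] (G : SimpleGraph V) (a b : ℕ) : Prop :=
  ∃ h : Sym2 V → ℝ, IsFractionalFactorIndicator G a b h

/-- `G` is a fractional `[a,b]`-deleted graph: for every edge `e` of `G`, the graph `G - e`
contains a fractional `[a,b]`-factor. -/
def IsFractionalDeleted {V : Type*} [Fintype V] (G : SimpleGraph V) (a b : ℕ) : Prop :=
  ∀ e ∈ G.edgeSet, HasFractionalFactor (G.deleteEdges {e}) a b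

end FracDeleted

namespace FracDeleted

open Finset

/-! ### Signless Laplacian: Rayleigh bound, monotonicity, edge count. -/

section Spectral

variable {V W : Type*} [Fintype V] [Fintype W]

/-! The two spectral hypotheses play separate roles. A vertex of degree at most `a` would make `G` a
spanning subgraph of the extremal graph (`exists_equiv_extremalGraph`), and the quadratic form makes
`q` monotone under adding edges; so the second hypothesis forces minimum degree at least `a + 1`.
The bound `μ ≤ d(v) + m(v)` turns the first into a degree sum above `(n-1)(n-2) + a + 1`
(`lt_sum_degree_of_hasEigenvalue`). What remains is combinatorial. Anstee's cut criterion,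
`hasFractionalFactor_of_cut`, comes from separating the degree vectors of edge weightings from the
box `[a,b]^V`, with a layer-cake integral reducing a real separating functional to cuts.
`mul_le_of_degree_bounds` then checks every cut of `G - e`. -/

open Classical in
lemma signlessLaplacian_mulVec_apply (G : SimpleGraph V) (x : V → ℝ) (v : V) :
    (signlessLaplacian G).mulVec x v = ∑ u, if G.Adj v u then x v + x u else 0 := by
  have hsplit : ∀ u, (if G.Adj v u then x v + x u else 0)
      = (if G.Adj v u then x v else 0) + (if G.Adj v u then x u else 0) := by
    intro u; split_ifs <;> simp
  simp only [hsplit, sum_add_distrib]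
  rw [signlessLaplacian, Matrix.add_mulVec, Pi.add_apply, SimpleGraph.degMatrix_mulVec_apply,
    SimpleGraph.adjMatrix_mulVec_apply, ← sum_filter, ← sum_filter, sum_const, nsmul_eq_mul,
    ← SimpleGraph.neighborFinset_eq_filter, SimpleGraph.card_neighborFinset_eq_degree]

open Classical in
lemma isHermitian_signlessLaplacian (G : SimpleGraph V) : (signlessLaplacian G).IsHermitian := by
  rw [Matrix.IsHermitian, Matrix.conjTranspose_eq_transpose_of_trivial, signlessLaplacian,
    Matrix.transpose_add, (G.isSymm_degMatrix ℝ).eq, (G.isSymm_adjMatrix).eq]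

open Classical in
/-- The quadratic form of the signless Laplacian. -/
lemma two_mul_dotProduct_signlessLaplacian_mulVec (G : SimpleGraph V) (x : V → ℝ) :
    2 * (x ⬝ᵥ (signlessLaplacian G).mulVec x)
      = ∑ v, ∑ u, if G.Adj v u then (x v + x u) ^ 2 else 0 := by
  have h1 : x ⬝ᵥ (signlessLaplacian G).mulVec x
      = ∑ v, ∑ u, if G.Adj v u then x v * (x v + x u) else 0 := by
    simp only [dotProduct, signlessLaplacian_mulVec_apply, mul_sum, mul_ite, mul_zero]
  have h2 : x ⬝ᵥ (signlessLaplacian G).mulVec x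
      = ∑ v, ∑ u, if G.Adj v u then x u * (x v + x u) else 0 := by
    rw [h1, sum_comm]
    refine sum_congr rfl fun v _ => sum_congr rfl fun u _ => ?_
    simp only [G.adj_comm u v, add_comm (x u) (x v)]
  rw [two_mul]
  nth_rewrite 1 [h1]
  rw [h2]
  simp only [← sum_add_distrib]
  refine sum_congr rfl fun v _ => sum_congr rfl fun u _ => ?_
  split_ifs <;> ring

lemma le_signlessSpectralRadius {G : SimpleGraph V} {μ : ℝ}
    (h : Module.End.HasEigenvalue (signlessLaplacian G).mulVecLin μ) :
    μ ≤ signlessSpectralRadius G :=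
  le_csSup (Module.End.finite_hasEigenvalue _).bddAbove h

/-- Each eigenvalue of `q • 1 - Q` is `q - μ` with `μ` an eigenvalue of `Q`, hence nonnegative. -/
lemma dotProduct_signlessLaplacian_mulVec_le (G : SimpleGraph V) (x : V → ℝ) :
    x ⬝ᵥ (signlessLaplacian G).mulVec x ≤ signlessSpectralRadius G * (x ⬝ᵥ x) := by
  classical
  set q := signlessSpectralRadius G with hq
  have hH : (q • (1 : Matrix V V ℝ) - signlessLaplacian G).IsHermitian := by
    refine Matrix.IsHermitian.sub ?_ (isHermitian_signlessLaplacian G)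
    rw [Matrix.IsHermitian, Matrix.conjTranspose_smul, Matrix.conjTranspose_one, star_trivial]
  have hpos : (q • (1 : Matrix V V ℝ) - signlessLaplacian G).PosSemidef := by
    rw [hH.posSemidef_iff_eigenvalues_nonneg]
    intro j
    have hj := hH.mulVec_eigenvectorBasis j
    have hne : (hH.eigenvectorBasis j).ofLp ≠ 0 := by
      intro h0
      have := hH.eigenvectorBasis.orthonormal.ne_zero j
      exact this (by ext i; exact congrFun h0 i)
    have hev : Module.End.HasEigenvalue (signlessLaplacian G).mulVecLin
        (q - hH.eigenvalues j) := by
      refine Module.End.hasEigenvalue_of_hasEigenvector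
        (x := (hH.eigenvectorBasis j).ofLp) ⟨?_, hne⟩
      rw [Module.End.mem_eigenspace_iff, Matrix.mulVecLin_apply, sub_smul, ← hj,
        Matrix.sub_mulVec, Matrix.smul_mulVec, Matrix.one_mulVec]
      abel
    have := le_signlessSpectralRadius hev
    simp only [Pi.zero_apply]
    linarith
  have := hpos.dotProduct_mulVec_nonneg x
  rw [star_trivial, Matrix.sub_mulVec, Matrix.smul_mulVec, Matrix.one_mulVec, dotProduct_sub,
    dotProduct_smul, smul_eq_mul] at this
  linarith

/-- The signless Laplacian spectral radius does not decrease when edges are added. -/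
lemma le_signlessSpectralRadius_of_adj_imp {G : SimpleGraph V} {H : SimpleGraph W} (φ : V ≃ W)
    (hφ : ∀ u v, G.Adj u v → H.Adj (φ u) (φ v)) {μ : ℝ}
    (h : Module.End.HasEigenvalue (signlessLaplacian G).mulVecLin μ) :
    μ ≤ signlessSpectralRadius H := by
  classical
  obtain ⟨x, hx⟩ := h.exists_hasEigenvector
  have hμ : (signlessLaplacian G).mulVec x = μ • x := hx.apply_eq_smul
  have hpos : 0 < x ⬝ᵥ x := by
    refine lt_of_le_of_ne (sum_nonneg fun i _ => mul_self_nonneg _) fun h0 => hx.2 ?_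
    exact dotProduct_self_eq_zero.1 h0.symm
  set y : W → ℝ := fun w => x (φ.symm w) with hy
  have hyy : y ⬝ᵥ y = x ⬝ᵥ x := by
    simp only [dotProduct]
    rw [← Equiv.sum_comp φ]
    simp [hy]
  have hle : x ⬝ᵥ (signlessLaplacian G).mulVec x ≤ y ⬝ᵥ (signlessLaplacian H).mulVec y := by
    have h2 : (2 : ℝ) * (x ⬝ᵥ (signlessLaplacian G).mulVec x)
        ≤ 2 * (y ⬝ᵥ (signlessLaplacian H).mulVec y) := by
      rw [two_mul_dotProduct_signlessLaplacian_mulVec, two_mul_dotProduct_signlessLaplacian_mulVec,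
        ← Equiv.sum_comp φ]
      refine sum_le_sum fun v _ => ?_
      rw [← Equiv.sum_comp φ]
      refine sum_le_sum fun u _ => ?_
      simp only [hy, Equiv.symm_apply_apply]
      by_cases hvu : G.Adj v u
      · simp [hvu, hφ v u hvu]
      · rw [if_neg hvu]
        positivity
    linarith
  have := dotProduct_signlessLaplacian_mulVec_le H y
  rw [hyy] at this
  rw [hμ, dotProduct_smul, smul_eq_mul] at hle
  exact le_of_mul_le_mul_right (hle.trans this) hpos

open Classical in
/-- An eigenvalue of the signless Laplacian is at most `d(v) + m(v)` for some vertex `v`, where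
`m(v)` is the average degree of the neighbours of `v`. -/
lemma exists_mul_degree_le {G : SimpleGraph V} (hd : ∀ v, 0 < G.degree v) {μ : ℝ}
    (h : Module.End.HasEigenvalue (signlessLaplacian G).mulVecLin μ) :
    ∃ v, μ * G.degree v ≤ (G.degree v : ℝ) ^ 2 + ∑ u ∈ G.neighborFinset v, (G.degree u : ℝ) := by
  obtain ⟨x, hx⟩ := h.exists_hasEigenvector
  have hμ : (signlessLaplacian G).mulVec x = μ • x := hx.apply_eq_smul
  obtain ⟨w, hw⟩ : ∃ w, x w ≠ 0 := by
    by_contra! h0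
    exact hx.2 (funext h0)
  have hd' : ∀ v, (0 : ℝ) < G.degree v := fun v => by exact_mod_cast hd v
  -- Dividing by degrees conjugates `Q` by `D`; row `v` of `D⁻¹QD` sums to `d(v) + m(v)`.
  obtain ⟨v, -, hv⟩ := exists_max_image univ (fun v => |x v| / G.degree v) ⟨w, mem_univ w⟩
  set c := |x v| / G.degree v with hc
  have hcpos : 0 < c := lt_of_lt_of_le (div_pos (abs_pos.2 hw) (hd' w)) (hv w (mem_univ w))
  have hxv : |x v| = c * G.degree v := by rw [hc, div_mul_cancel₀ _ (hd' v).ne']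
  have hxu : ∀ u, |x u| ≤ c * G.degree u := fun u => (div_le_iff₀ (hd' u)).1 (hv u (mem_univ u))
  have heq : μ * x v = G.degree v * x v + ∑ u ∈ G.neighborFinset v, x u := by
    have := congrFun hμ v
    rw [signlessLaplacian, Matrix.add_mulVec, Pi.add_apply, SimpleGraph.degMatrix_mulVec_apply,
      SimpleGraph.adjMatrix_mulVec_apply] at this
    simpa using this.symm
  have hsum : (μ - G.degree v) * |x v| ≤ ∑ u ∈ G.neighborFinset v, c * G.degree u := by
    calc (μ - G.degree v) * |x v| ≤ |(μ - G.degree v) * x v| := by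
          rw [abs_mul]
          exact mul_le_mul_of_nonneg_right (le_abs_self _) (abs_nonneg _)
      _ = |∑ u ∈ G.neighborFinset v, x u| := by
          congr 1
          linarith
      _ ≤ ∑ u ∈ G.neighborFinset v, |x u| := abs_sum_le_sum_abs _ _
      _ ≤ _ := sum_le_sum fun u _ => hxu u
  rw [← mul_sum, hxv] at hsum
  refine ⟨v, ?_⟩
  have : c * ((μ - G.degree v) * G.degree v) ≤ c * ∑ u ∈ G.neighborFinset v, (G.degree u : ℝ) := by
    linarith
  have := le_of_mul_le_mul_left this hcpos
  nlinarith

open Classical in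
/-- A connected graph whose signless Laplacian has a large eigenvalue has many edges. -/
lemma lt_sum_degree_of_hasEigenvalue {G : SimpleGraph V} {n : ℕ} (hcard : Fintype.card V = n)
    (hn : 3 ≤ n) (hd : ∀ v, 0 < G.degree v) {c μ : ℝ} (hc0 : 0 ≤ c) (hcn : c ≤ n - 1)
    (h : Module.End.HasEigenvalue (signlessLaplacian G).mulVecLin μ)
    (hμ : 2 * (n : ℝ) - 4 + c / ((n : ℝ) - 1) < μ) :
    ((n : ℝ) - 1) * (n - 2) + c < ∑ v, (G.degree v : ℝ) := by
  obtain ⟨v, hv⟩ := exists_mul_degree_le hd h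
  have hn' : (3 : ℝ) ≤ n := by exact_mod_cast hn
  have hdv : (0 : ℝ) < G.degree v := by exact_mod_cast hd v
  have hdeg : ∀ u, (G.degree u : ℝ) ≤ n - 1 := by
    intro u
    have := G.degree_lt_card_verts u
    rw [hcard] at this
    have : (G.degree u : ℝ) + 1 ≤ n := by exact_mod_cast this
    linarith
  have hNle : ∑ u ∈ G.neighborFinset v, (G.degree u : ℝ) ≤ G.degree v * ((n : ℝ) - 1) := by
    calc _ ≤ ∑ u ∈ G.neighborFinset v, ((n : ℝ) - 1) := sum_le_sum fun u _ => hdeg u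
      _ = _ := by rw [sum_const, nsmul_eq_mul, G.card_neighborFinset_eq_degree]
  have hcdiv : 0 ≤ c / ((n : ℝ) - 1) := div_nonneg hc0 (by linarith)
  have hlarge : (n : ℝ) - 3 < G.degree v := by
    by_contra! hlt
    have : μ * G.degree v ≤ G.degree v * (2 * n - 4) := by nlinarith
    nlinarith
  -- Remove `d(v)` and at least 1 for each of the `n - 1 - d(v)` non-neighbours.
  have htotal : ∑ u ∈ G.neighborFinset v, (G.degree u : ℝ)
      ≤ ∑ u, (G.degree u : ℝ) - ((n : ℝ) - 1) := by
    have hvN : v ∉ G.neighborFinset v := by simp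
    have hsplit := sum_add_sum_compl (insert v (G.neighborFinset v)) (fun u => (G.degree u : ℝ))
    rw [sum_insert hvN] at hsplit
    have hcompl : ((insert v (G.neighborFinset v))ᶜ.card : ℝ) = n - 1 - G.degree v := by
      rw [card_compl, card_insert_of_notMem hvN, G.card_neighborFinset_eq_degree, hcard,
        Nat.cast_sub]
      · push_cast; ring
      · rw [← hcard]; exact G.degree_lt_card_verts v
    have hone : ((insert v (G.neighborFinset v))ᶜ.card : ℝ)
        ≤ ∑ u ∈ (insert v (G.neighborFinset v))ᶜ, (G.degree u : ℝ) := by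
      rw [card_eq_sum_ones, Nat.cast_sum]
      exact sum_le_sum fun u _ => by exact_mod_cast hd u
    linarith
  have hcn1 : c / ((n : ℝ) - 1) ≤ 1 := (div_le_one (by linarith)).2 hcn
  have hcmul : c / ((n : ℝ) - 1) * (n - 1) = c := div_mul_cancel₀ _ (by linarith)
  have hcase : (G.degree v : ℝ) = n - 2 ∨ (G.degree v : ℝ) = n - 1 := by
    have h1 : n < G.degree v + 3 := by
      have : (n : ℝ) < G.degree v + 3 := by linarith
      exact_mod_cast this
    have h2 := G.degree_lt_card_verts v
    rw [hcard] at h2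
    have : G.degree v + 2 = n ∨ G.degree v + 1 = n := by omega
    rcases this with h | h
    · left; rw [← h]; push_cast; ring
    · right; rw [← h]; push_cast; ring
  rcases hcase with h | h <;> rw [h] at hv hdv <;> nlinarith

end Spectral

/-! ### Anstee's criterion by convex separation. -/

section Factor

variable {V : Type*} [Fintype V]

open Classical in
lemma sum_incidenceFinset (G : SimpleGraph V) (h : Sym2 V → ℝ) (v : V) :
    ∑ e ∈ G.incidenceFinset v, h e = ∑ u, if G.Adj v u then h s(v, u) else 0 := by
  rw [← sum_filter]
  symm
  refine sum_bij (fun u _ => s(v, u)) ?_ ?_ ?_ ?_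
  · intro u hu
    simpa [SimpleGraph.mem_incidenceFinset, SimpleGraph.mk'_mem_incidenceSet_iff] using hu
  · intro u _ w _ huw
    exact Sym2.congr_right.1 huw
  · intro e he
    rw [SimpleGraph.mem_incidenceFinset] at he
    obtain ⟨u, rfl⟩ := Sym2.mem_iff_exists.1 he.2
    exact ⟨u, by simpa using he.1, rfl⟩
  · simp

open Classical in
/-- The layer-cake form of the cut condition: if
`b |S| + ∑_{v ∈ T} d_{G - S}(v) ≥ a |T|` for all disjoint `S` and `T`, then the corresponding
inequality holds for every real weight on the vertices. -/
lemma sum_posPart_le_of_cut (G : SimpleGraph V) (a b : ℝ)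
    (hcut : ∀ S T : Finset V, Disjoint S T →
      a * T.card ≤ b * S.card + ∑ v ∈ T, ∑ u ∈ Sᶜ, if G.Adj v u then (1 : ℝ) else 0)
    (w : V → ℝ) :
    a * ∑ v, max (w v) 0 ≤ b * ∑ v, max (-w v) 0
      + ∑ v, ∑ u, if G.Adj v u then max (w v - max 0 (-w u)) 0 else 0 := by
  let I (x y θ : ℝ) : ℝ := (Set.Ioc x y).indicator (fun _ => (1 : ℝ)) θ
  have hI : ∀ x y, MeasureTheory.Integrable (I x y) := by
    intro x y
    exact (MeasureTheory.integrable_indicator_iff measurableSet_Ioc).2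
      (MeasureTheory.integrableOn_const (by simp) (by simp))
  have hint : ∀ x y, ∫ θ, I x y θ = max (y - x) 0 := by
    intro x y
    rw [MeasureTheory.integral_indicator_const _ measurableSet_Ioc, Real.volume_real_Ioc]
    simp
  have hIval : ∀ x y θ, I x y θ = if x < θ ∧ θ ≤ y then 1 else 0 := by
    intro x y θ
    simp [I, Set.indicator_apply]
  have hA : ∀ v u, MeasureTheory.Integrable
      (fun θ => if G.Adj v u then I (max 0 (-w u)) (w v) θ else 0) := by
    intro v u
    by_cases h : G.Adj v u
    · simpa [h] using hI _ _
    · simp [h]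
  -- For `θ > 0` this is the cut condition with `S = {w ≤ -θ}`, `T = {w ≥ θ}`; for `θ ≤ 0`
  -- everything vanishes.
  have hpt : ∀ θ : ℝ, 0 ≤ b * ∑ v, I 0 (-w v) θ
      + ∑ v, ∑ u, (if G.Adj v u then I (max 0 (-w u)) (w v) θ else 0)
      - a * ∑ v, I 0 (w v) θ := by
    intro θ
    rcases le_or_gt θ 0 with hθ | hθ
    · have h1 : ∀ y, I 0 y θ = 0 := fun y => by
        rw [hIval, if_neg]; exact fun h => absurd h.1 (not_lt.2 hθ)
      have h2 : ∀ u y, I (max 0 (-w u)) y θ = 0 := fun u y => by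
        rw [hIval, if_neg]
        exact fun h => absurd (lt_of_le_of_lt (le_max_left _ _) h.1) (not_lt.2 hθ)
      simp [h1, h2]
    · have hdis : Disjoint (univ.filter fun v => θ ≤ -w v) (univ.filter fun v => θ ≤ w v) := by
        rw [disjoint_filter]
        intro v _ h1 h2
        linarith
      have hc := hcut _ _ hdis
      have h1 : ∑ v, I 0 (-w v) θ = ((univ.filter fun v => θ ≤ -w v).card : ℝ) := by
        simp [hIval, hθ]
      have h2 : ∑ v, I 0 (w v) θ = ((univ.filter fun v => θ ≤ w v).card : ℝ) := by
        simp [hIval, hθ]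
      have h3 : ∑ v, ∑ u, (if G.Adj v u then I (max 0 (-w u)) (w v) θ else 0)
          = ∑ v ∈ univ.filter fun v => θ ≤ w v, ∑ u ∈ (univ.filter fun v => θ ≤ -w v)ᶜ,
            if G.Adj v u then (1 : ℝ) else 0 := by
        rw [compl_filter, sum_filter]
        refine sum_congr rfl fun v _ => ?_
        split_ifs with hv
        · rw [sum_filter]
          refine sum_congr rfl fun u _ => ?_
          simp only [hIval, max_lt_iff, hθ, hv, not_le, and_true, true_and]
          split_ifs <;> rfl
        · refine sum_eq_zero fun u _ => ?_
          simp [hIval, hv]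
      rw [h1, h2, h3]
      linarith
  have hnn := MeasureTheory.integral_nonneg (μ := MeasureTheory.volume)
    (f := fun θ => b * ∑ v, I 0 (-w v) θ
      + ∑ v, ∑ u, (if G.Adj v u then I (max 0 (-w u)) (w v) θ else 0)
      - a * ∑ v, I 0 (w v) θ) hpt
  have i1 : MeasureTheory.Integrable fun θ => b * ∑ v, I 0 (-w v) θ :=
    (MeasureTheory.integrable_finsetSum _ fun v _ => hI _ _).const_mul _
  have i2 : MeasureTheory.Integrable fun θ =>
      ∑ v, ∑ u, (if G.Adj v u then I (max 0 (-w u)) (w v) θ else 0) :=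
    MeasureTheory.integrable_finsetSum _ fun v _ => MeasureTheory.integrable_finsetSum _
      fun u _ => hA v u
  have i3 : MeasureTheory.Integrable fun θ => a * ∑ v, I 0 (w v) θ :=
    (MeasureTheory.integrable_finsetSum _ fun v _ => hI _ _).const_mul _
  have i12 : MeasureTheory.Integrable fun θ => b * ∑ v, I 0 (-w v) θ
      + ∑ v, ∑ u, (if G.Adj v u then I (max 0 (-w u)) (w v) θ else 0) := i1.add i2
  rw [MeasureTheory.integral_sub i12 i3, MeasureTheory.integral_add i1 i2,
    MeasureTheory.integral_const_mul, MeasureTheory.integral_const_mul,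
    MeasureTheory.integral_finsetSum _ fun v _ => hI _ _,
    MeasureTheory.integral_finsetSum _ fun v _ => hI _ _,
    MeasureTheory.integral_finsetSum _ fun v _ => MeasureTheory.integrable_finsetSum _
      fun u _ => hA v u] at hnn
  have h4 : ∀ v, ∫ θ, ∑ u, (if G.Adj v u then I (max 0 (-w u)) (w v) θ else 0)
      = ∑ u, if G.Adj v u then max (w v - max 0 (-w u)) 0 else 0 := by
    intro v
    rw [MeasureTheory.integral_finsetSum _ fun u _ => hA v u]
    refine sum_congr rfl fun u _ => ?_
    split_ifs
    · exact hint _ _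
    · simp
  simp only [hint, h4, sub_zero] at hnn
  linarith

/-- Matches the two orientations of an edge in the layer-cake sum with the most that edge can
contribute to the separating functional. -/
lemma max_sub_max_add_max_sub_max (x y : ℝ) :
    max (x - max 0 (-y)) 0 + max (y - max 0 (-x)) 0 = max (x + y) 0 := by
  rcases le_total x 0 with hx | hx <;> rcases le_total y 0 with hy | hy <;>
    rcases le_total (x + y) 0 with hxy | hxy <;>
    simp only [max_def] <;> split_ifs <;> linarith

open Classical in
/-- Anstee's criterion for fractional `[a,b]`-factors (sufficiency). -/
theorem hasFractionalFactor_of_cut (G : SimpleGraph V) (a b : ℕ) (hab : a ≤ b)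
    (hcut : ∀ S T : Finset V, Disjoint S T →
      (a : ℝ) * T.card ≤ b * S.card + ∑ v ∈ T, ∑ u ∈ Sᶜ, if G.Adj v u then (1 : ℝ) else 0) :
    HasFractionalFactor G a b := by
  have hab' : (a : ℝ) ≤ b := by exact_mod_cast hab
  let F : (V → V → ℝ) →ₗ[ℝ] (V → ℝ) :=
    { toFun := fun g v => ∑ u, if G.Adj v u then (g v u + g u v) / 2 else 0
      map_add' := by
        intro g g'
        ext v
        simp only [Pi.add_apply, ← sum_add_distrib]
        refine sum_congr rfl fun u _ => ?_
        split_ifs <;> ring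
      map_smul' := by
        intro c g
        ext v
        simp only [Pi.smul_apply, smul_eq_mul, RingHom.id_apply, mul_sum]
        refine sum_congr rfl fun u _ => ?_
        split_ifs <;> ring }
  have hF : ∀ g v, F g v = ∑ u, if G.Adj v u then (g v u + g u v) / 2 else 0 := fun _ _ => rfl
  let K : Set (V → V → ℝ) := Set.Icc 0 1
  by_cases hdis : Disjoint (F '' K) (Set.Icc (fun _ => (a : ℝ)) (fun _ => (b : ℝ)))
  · exfalso
    have hKc : IsCompact K := isCompact_Icc
    have hFc : Continuous F := F.continuous_of_finiteDimensional
    obtain ⟨f, s, t, hs, hst, ht⟩ := geometric_hahn_banach_compact_closed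
      ((convex_Icc (0 : V → V → ℝ) 1).linear_image F) (hKc.image hFc)
      (convex_Icc _ _) isClosed_Icc hdis
    set w : V → ℝ := fun v => f fun j => if v = j then 1 else 0 with hw
    have hf : ∀ x, f x = ∑ v, x v * w v := fun x => by
      simpa using LinearMap.pi_apply_eq_sum_univ (f : (V → ℝ) →ₗ[ℝ] ℝ) x
    -- `g` maximizes the functional over the cube of weights; the box point below minimizes it.
    let g : V → V → ℝ := fun v u => if 0 < w v + w u then 1 else 0
    have hg : g ∈ K := by
      refine ⟨fun v u => ?_, fun v u => ?_⟩ <;> simp only [g] <;> split_ifs <;> simp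
    have h1 := hs _ ⟨g, hg, rfl⟩
    have h2 := ht (fun v => if 0 < w v then (a : ℝ) else b) (by
      refine ⟨fun v => ?_, fun v => ?_⟩ <;> dsimp only <;> split_ifs <;> simp [hab'])
    have hlt := h1.trans (hst.trans h2)
    rw [hf, hf] at hlt
    have hbox : ∑ v, (if 0 < w v then (a : ℝ) else b) * w v
        = a * ∑ v, max (w v) 0 - b * ∑ v, max (-w v) 0 := by
      rw [mul_sum, mul_sum, ← sum_sub_distrib]
      refine sum_congr rfl fun v _ => ?_
      split_ifs with h
      · rw [max_eq_left h.le, max_eq_right (by linarith)]; ring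
      · rw [max_eq_right (by linarith), max_eq_left (by linarith)]; ring
    have hcomm : ∀ φ : V → V → ℝ, ∑ v, ∑ u, (if G.Adj v u then φ v u else 0)
        = ∑ v, ∑ u, (if G.Adj v u then φ u v else 0) := by
      intro φ
      rw [sum_comm]
      simp only [G.adj_comm]
    have hFg : ∑ v, F g v * w v
        = ∑ v, ∑ u, if G.Adj v u then max (w v - max 0 (-w u)) 0 else 0 := by
      have e1 : ∑ v, F g v * w v = ∑ v, ∑ u, if G.Adj v u then g v u * w v else 0 := by
        refine sum_congr rfl fun v _ => ?_
        rw [hF, sum_mul]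
        refine sum_congr rfl fun u _ => ?_
        have : g u v = g v u := by simp only [g, add_comm]
        rw [this]
        split_ifs <;> ring
      have e2 := hcomm fun v u => g v u * w v
      have e3 := hcomm fun v u => max (w v - max 0 (-w u)) 0
      have e4 : (∑ v, ∑ u, if G.Adj v u then g v u * w v else 0)
            + (∑ v, ∑ u, if G.Adj v u then g u v * w u else 0)
          = (∑ v, ∑ u, if G.Adj v u then max (w v - max 0 (-w u)) 0 else 0)
            + ∑ v, ∑ u, if G.Adj v u then max (w u - max 0 (-w v)) 0 else 0 := by
        simp only [← sum_add_distrib]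
        refine sum_congr rfl fun v _ => sum_congr rfl fun u _ => ?_
        split_ifs with h
        · rw [max_sub_max_add_max_sub_max]
          simp only [g, add_comm (w u) (w v)]
          split_ifs with h0
          · rw [max_eq_left h0.le]; ring
          · rw [max_eq_right (not_lt.1 h0)]; ring
        · simp
      linarith
    have := sum_posPart_le_of_cut G a b hcut w
    rw [hbox, hFg] at hlt
    linarith
  · obtain ⟨_, ⟨g, hg, rfl⟩, hab⟩ := Set.not_disjoint_iff.1 hdis
    refine ⟨Sym2.lift ⟨fun v u => (g v u + g u v) / 2, fun v u => by ring⟩, ?_, ?_⟩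
    · intro e _
      induction e with
      | _ v u =>
        have h1 := hg.1 v u
        have h2 := hg.2 v u
        have h3 := hg.1 u v
        have h4 := hg.2 u v
        simp only [Pi.zero_apply, Pi.one_apply] at h1 h2 h3 h4
        constructor <;> simp only [Sym2.lift_mk] <;> linarith
    · intro v
      rw [sum_incidenceFinset]
      exact ⟨hab.1 v, hab.2 v⟩

end Factor

/-! ### Embedding in the extremal graph and checking the cuts. -/

section Deleted

variable {V : Type*} [Fintype V]

lemma extremalGraph_adj {n a : ℕ} {p q : Fin a ⊕ (Fin (n - a - 1) ⊕ Fin 1)} :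
    (extremalGraph n a).Adj p q ↔ p ≠ q ∧
      ¬ ((∃ i j, p = .inr (.inl i) ∧ q = .inr (.inr j)) ∨
        ∃ i j, p = .inr (.inr i) ∧ q = .inr (.inl j)) := by
  rcases p with p | p | p <;> rcases q with q | q | q <;> simp [extremalGraph, join]

open Classical in
/-- A graph with a vertex of degree at most `a` is a spanning subgraph of `extremalGraph n a`. -/
lemma exists_equiv_extremalGraph (G : SimpleGraph V) {n a : ℕ} (hcard : Fintype.card V = n)
    (han : a + 1 ≤ n) {v : V} (hv : G.degree v ≤ a) :
    ∃ φ : V ≃ Fin a ⊕ (Fin (n - a - 1) ⊕ Fin 1),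
      ∀ x y, G.Adj x y → (extremalGraph n a).Adj (φ x) (φ y) := by
  -- Pad the neighbourhood of `v` to exactly `a` vertices, the future `K_a`.
  obtain ⟨A, hNA, hAv, hA⟩ := exists_subsuperset_card_eq (s := G.neighborFinset v)
    (t := univ.erase v) (n := a)
    (fun u hu => by
      rw [SimpleGraph.mem_neighborFinset] at hu
      simpa using hu.ne')
    (by rwa [G.card_neighborFinset_eq_degree])
    (by rw [card_erase_of_mem (mem_univ v), card_univ, hcard]; omega)
  have hvA : v ∉ A := fun h => by simpa using hAv h
  have e₁ : {x // x ∈ A} ≃ Fin a := Fintype.equivOfCardEq (by simp [hA])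
  have e₀ : {x // ¬ x ∈ A} ≃ Fin (n - a - 1) ⊕ Fin 1 := Fintype.equivOfCardEq (by
    rw [Fintype.card_subtype_compl]
    simp only [hcard, Fintype.card_coe, hA, Fintype.card_sum, Fintype.card_fin]
    omega)
  let e₂ : {x // ¬ x ∈ A} ≃ Fin (n - a - 1) ⊕ Fin 1 :=
    e₀.trans (Equiv.swap (e₀ ⟨v, hvA⟩) (.inr 0))
  have he₂ : e₂ ⟨v, hvA⟩ = .inr 0 := by simp [e₂]
  let φ := (Equiv.sumCompl (· ∈ A)).symm.trans (Equiv.sumCongr e₁ e₂)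
  have hφ : ∀ x (j : Fin 1), φ x = .inr (.inr j) → x = v := by
    intro x j hx
    have hφv : φ v = .inr (.inr 0) := by
      simp [φ, Equiv.sumCompl_symm_apply_of_neg hvA, he₂]
    apply φ.injective
    rw [hx, hφv, Subsingleton.elim j 0]
  have hφN : ∀ y i, φ y = .inr (.inl i) → ¬ G.Adj v y := by
    intro y i hy hvy
    have hyA : y ∈ A := hNA (by simpa using hvy)
    simp [φ, Equiv.sumCompl_symm_apply_of_pos hyA] at hy
  refine ⟨φ, fun x y hxy => extremalGraph_adj.2 ⟨φ.injective.ne hxy.ne, ?_⟩⟩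
  rintro (⟨i, j, hx, hy⟩ | ⟨i, j, hx, hy⟩)
  · obtain rfl := hφ y j hy
    exact hφN x i hx hxy.symm
  · obtain rfl := hφ x i hx
    exact hφN y j hy hxy

open Classical in
lemma degree_sub_le_sum_deleteEdges (G : SimpleGraph V) (e : Sym2 V) (S : Finset V) (v : V) :
    (G.degree v : ℤ) - (if v ∈ e then 1 else 0) - S.card
      ≤ ∑ u ∈ Sᶜ, if (G.deleteEdges {e}).Adj v u then (1 : ℤ) else 0 := by
  have h1 : ∑ u ∈ S, (if (G.deleteEdges {e}).Adj v u then (1 : ℤ) else 0) ≤ S.card := by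
    rw [card_eq_sum_ones, Nat.cast_sum]
    exact sum_le_sum fun u _ => by split_ifs <;> simp
  have h2 : (G.degree v : ℤ) = ∑ u, if G.Adj v u then (1 : ℤ) else 0 := by
    rw [← G.card_neighborFinset_eq_degree, G.neighborFinset_eq_filter, card_filter]
    push_cast
    rfl
  have h3 : ∑ u, (if s(v, u) = e then (1 : ℤ) else 0) ≤ if v ∈ e then 1 else 0 := by
    split_ifs with hv
    · obtain ⟨z, rfl⟩ := Sym2.mem_iff_exists.1 hv
      have : ∀ u, s(v, u) = s(v, z) ↔ u = z := fun u => Sym2.congr_right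
      simp only [this]
      simp
    · refine (sum_eq_zero fun u _ => if_neg ?_).le
      rintro rfl
      exact hv (Sym2.mem_mk_left v u)
  have h4 : ∑ u, (if G.Adj v u then (1 : ℤ) else 0)
      ≤ ∑ u, (if (G.deleteEdges {e}).Adj v u then (1 : ℤ) else 0)
        + ∑ u, (if s(v, u) = e then (1 : ℤ) else 0) := by
    rw [← sum_add_distrib]
    refine sum_le_sum fun u _ => ?_
    simp only [SimpleGraph.deleteEdges_adj, Set.mem_singleton_iff]
    by_cases h : G.Adj v u <;> by_cases h' : s(v, u) = e <;> simp [h, h']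
  have h5 := sum_add_sum_compl S fun u => if (G.deleteEdges {e}).Adj v u then (1 : ℤ) else 0
  linarith

open Classical in
lemma sum_mem_sym2_le_two (e : Sym2 V) : ∑ v, (if v ∈ e then (1 : ℤ) else 0) ≤ 2 := by
  induction e with
  | _ x y =>
    have h : univ.filter (fun v => v ∈ s(x, y)) = {x, y} := by ext; simp
    rw [sum_boole, h]
    exact_mod_cast card_le_two

/-- The numerical core of the cut condition: `s = |S|`, `t = |T|`, and `E` is the sum over `T` of
the degrees in `G`, each lowered by one at the ends of the deleted edge. -/
lemma mul_le_of_degree_bounds {a b n s t E : ℤ} (ha : 1 ≤ a) (hab : a ≤ b) (hb : 3 ≤ b)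
    (han : a + 2 ≤ n) (hn : 7 ≤ n) (hs : 0 ≤ s) (ht : 0 ≤ t) (hst : s + t ≤ n)
    (h₁ : t * a ≤ E) (h₂ : t * (a + 1) - 2 ≤ E) (h₃ : t * (n - 1) - (2 * n - a - 2) ≤ E) :
    a * t ≤ b * s + (E - t * s) := by
  rcases le_or_gt t b with htb | htb
  · nlinarith [mul_nonneg hs (sub_nonneg.2 htb)]
  obtain rfl | rfl | hs2 : s = 0 ∨ s = 1 ∨ 2 ≤ s := by omega
  · linarith
  · linarith
  by_contra! hlt
  obtain ⟨k, rfl⟩ : ∃ k, n = a + k + 1 := ⟨n - a - 1, by ring⟩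
  obtain ⟨u, rfl⟩ : ∃ u, t = b + u := ⟨t - b, by ring⟩
  have hu : 1 ≤ u := by linarith
  have hsk : s ≤ k + 1 - u := by linarith
  have hk : 2 ≤ k := by linarith
  -- Insert `h₃` into the negated goal, then use `k - s ≥ u - 1`.
  have hkey : b * k - u + u ^ 2 ≤ a + 2 * k - 1 := by
    have := mul_le_mul_of_nonneg_left hsk (by linarith : (0 : ℤ) ≤ u)
    nlinarith
  have hu2 : u ≤ u ^ 2 := by nlinarith
  have hbk : (b - 2) * (k - 1) ≤ 1 := by nlinarith
  have hb3 : b = 3 := by nlinarith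
  -- Now `k = 2`, so `n = a + 3 ≤ 6`, against `n ≥ 7`.
  subst hb3
  linarith

open Classical in
/-- A graph of minimum degree at least `a + 1` with sufficiently many edges is a fractional
`[a,b]`-deleted graph. -/
theorem isFractionalDeleted_of_degree {G : SimpleGraph V} {a b n : ℕ} (ha : 1 ≤ a) (hab : a ≤ b)
    (hb : 3 ≤ b) (hcard : Fintype.card V = n) (han : a + 2 ≤ n) (hn : 7 ≤ n)
    (hdeg : ∀ v, a + 1 ≤ G.degree v)
    (hsum : ((n : ℤ) - 1) * (n - 2) + (a + 1) < ∑ v, (G.degree v : ℤ)) :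
    IsFractionalDeleted G a b := by
  intro e _
  refine hasFractionalFactor_of_cut _ a b hab fun S T hST => ?_
  let c : V → ℤ := fun v => if v ∈ e then 1 else 0
  have hc0 : ∀ v, 0 ≤ c v := fun v => by simp only [c]; split_ifs <;> simp
  have hc1 : ∀ v, c v ≤ 1 := fun v => by simp only [c]; split_ifs <;> simp
  have hcsum : ∑ v, c v ≤ 2 := sum_mem_sym2_le_two e
  have hcT : ∑ v ∈ T, c v ≤ 2 :=
    (sum_le_univ_sum_of_nonneg hc0).trans hcsum
  have hdeg' : ∀ v, (a : ℤ) + 1 ≤ G.degree v := fun v => by exact_mod_cast hdeg v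
  have hdegn : ∀ v, (G.degree v : ℤ) ≤ n - 1 := fun v => by
    have := G.degree_lt_card_verts v
    omega
  set E : ℤ := ∑ v ∈ T, ((G.degree v : ℤ) - c v) with hE
  have hEsub : E = ∑ v ∈ T, (G.degree v : ℤ) - ∑ v ∈ T, c v := sum_sub_distrib _ _
  have h₁ : (T.card : ℤ) * a ≤ E := by
    rw [← nsmul_eq_mul]
    exact card_nsmul_le_sum _ _ _ fun v _ => by linarith [hdeg' v, hc1 v]
  have h₂ : (T.card : ℤ) * (a + 1) - 2 ≤ E := by
    have : (T.card : ℤ) * (a + 1) ≤ ∑ v ∈ T, (G.degree v : ℤ) := by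
      rw [← nsmul_eq_mul]
      exact card_nsmul_le_sum _ _ _ fun v _ => hdeg' v
    linarith
  -- The deficiencies `n - 1 - d(v)` total at most `2n - a - 4`; the ends of `e` cost 2 more.
  have h₃ : (T.card : ℤ) * (n - 1) - (2 * n - a - 2) ≤ E := by
    have hT : ∑ v ∈ T, ((n : ℤ) - 1 - G.degree v) ≤ ∑ v, ((n : ℤ) - 1 - G.degree v) :=
      sum_le_univ_sum_of_nonneg fun v => by linarith [hdegn v]
    simp only [sum_sub_distrib (fun _ : V => (n : ℤ) - 1), sum_const, nsmul_eq_mul, card_univ,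
      hcard] at hT
    have : ((n : ℤ) - 1) * (n - 2) + (a + 1) + 1 ≤ ∑ v, (G.degree v : ℤ) := hsum
    linarith
  have hst : (S.card : ℤ) + T.card ≤ n := by
    rw [← hcard]
    exact_mod_cast (card_union_of_disjoint hST).symm.trans_le (card_le_univ _)
  have hcore := mul_le_of_degree_bounds (a := a) (b := b) (n := n) (s := S.card) (t := T.card)
    (E := E) (by exact_mod_cast ha) (by exact_mod_cast hab) (by exact_mod_cast hb)
    (by exact_mod_cast han) (by exact_mod_cast hn) (by positivity) (by positivity) hst h₁ h₂ h₃
  have hlow : E - T.card * S.card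
      ≤ ∑ v ∈ T, ∑ u ∈ Sᶜ, if (G.deleteEdges {e}).Adj v u then (1 : ℤ) else 0 := by
    rw [hE, ← nsmul_eq_mul, ← sum_const, ← sum_sub_distrib]
    exact sum_le_sum fun v _ => degree_sub_le_sum_deleteEdges G e S v
  have hfin := hcore.trans (add_le_add_right hlow _)
  exact_mod_cast hfin

end Deleted

end FracDeleted

theorem theorem1p6 {V : Type*} [Fintype V] (G : SimpleGraph V) (a b n : ℕ)
    (ha : 1 ≤ a) (hb : max a 3 ≤ b)
    (hcard : Fintype.card V = n) (hn : max (a + 2) 7 ≤ n)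
    (hG : G.Connected)
    (hq : 2 * (n : ℝ) - 4 + ((a : ℝ) + 1) / ((n : ℝ) - 1)
      < FracDeleted.signlessSpectralRadius G)
    (hext : FracDeleted.signlessSpectralRadius (FracDeleted.extremalGraph n a)
      < FracDeleted.signlessSpectralRadius G) :
    FracDeleted.IsFractionalDeleted G a b := by
  classical
  obtain ⟨hab, hb3⟩ := max_le_iff.1 hb
  obtain ⟨han, hn7⟩ := max_le_iff.1 hn
  have hn7' : (7 : ℝ) ≤ n := by exact_mod_cast hn7
  have hne : {μ : ℝ | Module.End.HasEigenvalue
      (FracDeleted.signlessLaplacian G).mulVecLin μ}.Nonempty := by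
    -- An empty supremum would be 0, below the first threshold.
    rw [Set.nonempty_iff_ne_empty]
    intro h0
    rw [FracDeleted.signlessSpectralRadius, h0, Real.sSup_empty] at hq
    have : (0 : ℝ) ≤ ((a : ℝ) + 1) / ((n : ℝ) - 1) :=
      div_nonneg (by positivity) (by linarith)
    linarith
  -- One eigenvalue beats both thresholds, so the supremum need not be shown to be attained.
  obtain ⟨μ, hμ, hlt⟩ := exists_lt_of_lt_csSup hne (max_lt hq hext)
  obtain ⟨hμq, hμext⟩ := max_lt_iff.1 hlt
  have hdeg : ∀ v, a + 1 ≤ G.degree v := by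
    intro v
    by_contra! hv
    obtain ⟨φ, hφ⟩ := FracDeleted.exists_equiv_extremalGraph G hcard (by omega)
      (Nat.le_of_lt_succ hv)
    exact hμext.not_ge (FracDeleted.le_signlessSpectralRadius_of_adj_imp φ hφ hμ)
  have hsum := FracDeleted.lt_sum_degree_of_hasEigenvalue hcard (by omega)
    (fun v => by have := hdeg v; omega) (c := (a : ℝ) + 1) (by positivity)
    (by
      have : (a : ℝ) + 2 ≤ n := by exact_mod_cast han
      linarith) hμ hμq
  exact FracDeleted.isFractionalDeleted_of_degree ha hab hb3 hcard han hn7 hdeg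
    (by exact_mod_cast hsum)
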